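/- Let $d\in\mathbb N$. For a finite set $s$ of $a\ge 2$ points of $\mathbb{R}^d$, the volume of $s$ means the $(a-1)$-dimensional Euclidean volume of its convex hull, that is, of the simplex spanned by $s$ (length for $a=2$, area for $a=3$, etc.; it is $0$ exactly when $s$ is affinely dependent). A set $Y\subseteq\mathbb{R}^d$ is strongly $a$-rainbow if every $a$-element subset of $Y$ has nonzero volume and any two distinct $a$-element subsets of $Y$ have distinct volumes. For $a\ge 2$, $Y$ is strictly $a$-rainbow if it is strongly $b$-rainbow for every $2\le b\le a$ and it is contained in an $(a-1)$-dimensional affine subspace of $\mathbb{R}^d$. Theorem. Let $\kappa\le 2^{\aleph_0}$ be an infinite regular cardinal and let $X\subseteq\mathbb{R}^d$ have cardinality $\kappa$. Then there are a subset $Y\subseteq X$ of cardinality $\kappa$ and an integer $a$ with $2\le a\le d+1$ such that $Y$ is strictly $a$-rainbow. -/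

import Mathlib

open Cardinal MeasureTheory

namespace Rainbow

/-- The `(a - 1)`-dimensional volume of the simplex spanned by an `a`-element set `s` of points of
`ℝ^d`: the Euclidean (normalized Hausdorff) measure of dimension `a - 1` of its convex hull.
Here `μHE[k]` is Hausdorff measure scaled so as to agree with Lebesgue measure on `ℝ^k`, so this is
length for `a = 2`, area for `a = 3`, and so on; it vanishes when `s` is affinely dependent. -/
noncomputable def simplexVolume {d : ℕ} (s : Finset (EuclideanSpace ℝ (Fin d))) : ENNReal :=
  μHE[s.card - 1] (convexHull ℝ (s : Set (EuclideanSpace ℝ (Fin d))))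

/-- All `a`-element subsets of `X` have nonzero volume, and distinct ones have distinct volumes. -/
def IsStronglyRainbow {d : ℕ} (a : ℕ) (X : Set (EuclideanSpace ℝ (Fin d))) : Prop :=
  (∀ s : Finset (EuclideanSpace ℝ (Fin d)),
    (s : Set (EuclideanSpace ℝ (Fin d))) ⊆ X → s.card = a → simplexVolume s ≠ 0) ∧
  ∀ s t : Finset (EuclideanSpace ℝ (Fin d)),
    (s : Set (EuclideanSpace ℝ (Fin d))) ⊆ X → (t : Set (EuclideanSpace ℝ (Fin d))) ⊆ X →
      s.card = a → t.card = a → s ≠ t → simplexVolume s ≠ simplexVolume t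

/-- `X` is strongly `b`-rainbow for all `2 ≤ b ≤ a`, and `X` is contained in an affine subspace of
dimension `a - 1`. (The value `b = 1` is not meant: one-point sets span no volume, and their
`0`-dimensional measures all coincide.) -/
def IsStrictlyRainbow {d : ℕ} (a : ℕ) (X : Set (EuclideanSpace ℝ (Fin d))) : Prop :=
  (∀ b : ℕ, 2 ≤ b → b ≤ a → IsStronglyRainbow b X) ∧
  ∃ H : AffineSubspace ℝ (EuclideanSpace ℝ (Fin d)),
    (H : Set (EuclideanSpace ℝ (Fin d))).Nonempty ∧
      Module.finrank ℝ H.direction + 1 = a ∧ X ⊆ H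

end Rainbow

/-! Polynomial rings over ℝ in finitely many variables are Noetherian, so among the subsets of X of
size κ some X' has a maximal vanishing ideal. A polynomial with κ zeros on X' then vanishes on X'
(`exists_subset_mk_zeros_lt`).

Let D be the dimension of the affine hull of X', and take a = D + 1. Volumes are fixed multiples of
square roots of Gram determinants, so being rainbow for 2 ≤ b ≤ D + 1 means that finitely many
polynomials vanish at no injective tuple of points. None of them is identically zero on tuples from
X', as X' contains D + 1 affinely independent points.

A maximal generic Y ⊆ X' has size κ (`exists_generic_subset`): otherwise fewer than κ constraints
each exclude fewer than κ points, and regularity leaves a point to add. -/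

namespace Rainbow

open MvPolynomial

/-! ### Small zero sets and generic subsets -/

/-- Every set contains an equinumerous subset on which a polynomial either vanishes identically or
has fewer zeros than the set has points. -/
theorem exists_subset_mk_zeros_lt {α σ : Type} [Finite σ] (φ : α → σ → ℝ) (X : Set α) :
    ∃ X' ⊆ X, #X' = #X ∧ ∀ p : MvPolynomial σ ℝ, (∃ x ∈ X', eval (φ x) p ≠ 0) →
      #{x : X' | eval (φ x) p = 0} < #X := by
  let S : Set (Ideal (MvPolynomial σ ℝ)) :=
    {I | ∃ X' ⊆ X, #X' = #X ∧ I = vanishingIdeal ℝ (φ '' X')}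
  have hS : S.Nonempty := ⟨_, X, subset_rfl, rfl, rfl⟩
  obtain ⟨I, ⟨X', hX', hcard, rfl⟩, hmax⟩ := WellFounded.has_min
    (wellFounded_gt (α := Ideal (MvPolynomial σ ℝ))) S hS
  refine ⟨X', hX', hcard, fun p ⟨x, hx, hpx⟩ => ?_⟩
  have hle : #{x : X' | eval (φ x) p = 0} ≤ #X := hcard ▸ mk_set_le _
  refine lt_of_le_of_ne hle fun heq => ?_
  let Z : Set α := Subtype.val '' {x : X' | eval (φ x) p = 0}
  have hZX : Z ⊆ X' := by rintro _ ⟨z, -, rfl⟩; exact z.2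
  have hZ : #Z = #X := by rw [← heq]; exact mk_image_eq Subtype.val_injective
  -- By maximality `Z` and `X'` have the same vanishing ideal, which contains `p`.
  refine hmax _ ⟨Z, hZX.trans hX', hZ, rfl⟩ (lt_of_le_of_ne
    (vanishingIdeal_anti_mono (Set.image_mono hZX)) fun h => hpx ?_)
  have hp : p ∈ vanishingIdeal ℝ (φ '' Z) := by
    rw [mem_vanishingIdeal_iff]
    rintro _ ⟨_, ⟨z, hz, rfl⟩, rfl⟩
    simpa [aeval_eq_eval] using hz
  rw [← h, mem_vanishingIdeal_iff] at hp
  simpa [aeval_eq_eval] using hp _ ⟨x, hx, rfl⟩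

/-- The evaluation of a polynomial in the coordinates of an `ι`-tuple of points. -/
noncomputable def evalTuple {α σ ι : Type} (φ : α → σ → ℝ) (p : MvPolynomial (ι × σ) ℝ)
    (z : ι → α) : ℝ :=
  eval (fun q => φ (z q.1) q.2) p

/-- With all points but one fixed, a polynomial in a tuple is a polynomial in the free point. -/
theorem exists_eval_eq_evalTuple_update {α σ ι : Type} [DecidableEq ι] (φ : α → σ → ℝ)
    (p : MvPolynomial (ι × σ) ℝ) (z : ι → α) (i : ι) :
    ∃ r : MvPolynomial σ ℝ, ∀ x, eval (φ x) r = evalTuple φ p (Function.update z i x) := by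
  refine ⟨aeval (fun q : ι × σ => if q.1 = i then X q.2 else C (φ (z q.1) q.2)) p, fun x => ?_⟩
  change aeval (φ x) (aeval _ p) = eval _ p
  rw [← AlgHom.comp_apply, comp_aeval, ← aeval_eq_eval]
  congr 2
  ext ⟨k, c⟩
  by_cases hk : k = i
  · subst hk
    simp
  · simp [hk]

/-- A set all of whose injective partial tuples extend to a tuple at which no member of the family
of polynomials vanishes individually. -/
def genericSets {α σ ι J : Type} (φ : α → σ → ℝ) (P : J → MvPolynomial (ι × σ) ℝ) :
    Set (Set α) :=
  {Y | ∀ j (u : ι → Option α), (∀ i y, u i = some y → y ∈ Y) →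
    (∀ i i' y, u i = some y → u i' = some y → i = i') →
      ∃ z : ι → α, (∀ i y, u i = some y → z i = y) ∧ evalTuple φ (P j) z ≠ 0}

/-- A partial tuple involves only finitely many points. This is what makes Zorn's lemma applicable.
-/
theorem isOfFiniteCharacter_genericSets {α σ ι J : Type} [Finite ι] (φ : α → σ → ℝ)
    (P : J → MvPolynomial (ι × σ) ℝ) : Order.IsOfFiniteCharacter (genericSets φ P) := by
  refine fun Y => ⟨fun hY Z hZ _ j u hu hinj => hY j u (fun i y h => hZ (hu i y h)) hinj,
    fun h j u hu hinj => ?_⟩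
  refine h {y | ∃ i, u i = some y} ?_ ?_ j u (fun i y h => ⟨i, h⟩) hinj
  · rintro y ⟨i, hi⟩
    exact hu i y hi
  · refine ((Set.finite_range u).preimage (f := some)
      (Option.some_injective α).injOn).subset ?_
    rintro y ⟨i, hi⟩
    exact ⟨i, hi⟩

/-- If each polynomial of a finite family is nonzero at some tuple, then some equinumerous subset has
no injective tuple at which a member of the family vanishes. -/
theorem exists_generic_subset {α σ ι J : Type} [Finite ι] [Finite J]
    (φ : α → σ → ℝ) (hreg : (#α).IsRegular)
    (hmin : ∀ p : MvPolynomial σ ℝ, (∃ x, eval (φ x) p ≠ 0) → #{x | eval (φ x) p = 0} < #α)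
    (P : J → MvPolynomial (ι × σ) ℝ) (hP : ∀ j, ∃ z, evalTuple φ (P j) z ≠ 0) :
    ∃ Y : Set α, #Y = #α ∧ ∀ j (z : ι → α), Function.Injective z → (∀ i, z i ∈ Y) →
      evalTuple φ (P j) z ≠ 0 := by
  classical
  have hempty : (∅ : Set α) ∈ genericSets φ P := fun j u hu _ => by
    obtain ⟨z, hz⟩ := hP j
    exact ⟨z, fun i y h => (hu i y h).elim, hz⟩
  obtain ⟨Y, -, hY, hYmax⟩ :=
    (isOfFiniteCharacter_genericSets φ P).exists_maximal hempty
  refine ⟨Y, ?_, fun j z hz hzY => ?_⟩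
  · by_contra hne
    have hlt : #Y < #α := lt_of_le_of_ne (mk_set_le _) hne
    -- The points that cannot fill slot `i` of the partial tuple `u` without killing every
    -- extension.
    let bad : J × ι × (ι → Option Y) → Set α := fun t =>
      {x | (∀ i i' y, t.2.2 i = some y → t.2.2 i' = some y → i = i') ∧ t.2.2 t.2.1 = none ∧
        ∀ z : ι → α, (∀ i y, t.2.2 i = some y → z i = y) →
          evalTuple φ (P t.1) (Function.update z t.2.1 x) = 0}
    have hbad : ∀ t, #(bad t) < #α := by
      rintro ⟨j, i, u⟩
      by_cases hinj : ∀ i i' y, u i = some y → u i' = some y → i = i'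
      -- Bad points are zeros of the one-point polynomial got by freeing slot `i` of a nonvanishing
      -- extension `z`; it is nonzero at `z i`.
      · obtain ⟨z, hz, hz0⟩ := hY j (fun i => (u i).map Subtype.val)
          (fun i y h => by
            obtain ⟨y', -, rfl⟩ := Option.map_eq_some_iff.1 h
            exact y'.2)
          (fun i i' y h h' => by
            obtain ⟨y₁, h₁, rfl⟩ := Option.map_eq_some_iff.1 h
            obtain ⟨y₂, h₂, h₁₂⟩ := Option.map_eq_some_iff.1 h'
            exact hinj i i' y₁ h₁ (Subtype.ext h₁₂ ▸ h₂))
        obtain ⟨r, hr⟩ := exists_eval_eq_evalTuple_update φ (P j) z i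
        refine (mk_le_mk_of_subset ?_).trans_lt (hmin r ⟨z i, by
          rwa [hr, Function.update_eq_self]⟩)
        rintro x ⟨-, -, hx⟩
        rw [Set.mem_ofPred_eq, hr]
        exact hx z fun i y h => hz i y (Option.map_eq_some_iff.2 ⟨y, h, rfl⟩)
      · have : bad (j, i, u) = ∅ := Set.eq_empty_of_forall_notMem fun x hx => hinj hx.1
        rw [this, mk_eq_zero]
        exact hreg.pos
    have hindex : #(J × ι × (ι → Option Y)) < #α := by
      have hOpt : #(ι → Option Y) < #α := by
        rw [← power_def]
        obtain ⟨n, hn⟩ := lt_aleph0.1 (lt_aleph0_of_finite ι)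
        rw [hn]
        have h1 : #(Option Y) < #α := by
          rw [mk_option]
          exact add_lt_of_lt hreg.aleph0_le hlt (one_lt_aleph0.trans_le hreg.aleph0_le)
        rcases lt_or_ge #(Option Y) ℵ₀ with h | h
        · exact (power_lt_aleph0 h natCast_lt_aleph0).trans_le hreg.aleph0_le
        · exact (power_nat_le h).trans_lt h1
      simp only [mk_prod, lift_id]
      exact mul_lt_of_lt hreg.aleph0_le ((lt_aleph0_of_finite J).trans_le hreg.aleph0_le)
        (mul_lt_of_lt hreg.aleph0_le ((lt_aleph0_of_finite ι).trans_le hreg.aleph0_le) hOpt)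
    have hU : #(⋃ t, bad t) < #α :=
      (card_iUnion_lt_iff_forall_of_isRegular hreg hindex).2 hbad
    have hUY : #(Y ∪ ⋃ t, bad t : Set α) < #α :=
      (mk_union_le _ _).trans_lt (add_lt_of_lt hreg.aleph0_le hlt hU)
    obtain ⟨x, hx⟩ : ∃ x, x ∉ Y ∪ ⋃ t, bad t := by
      by_contra! h
      rw [Set.eq_univ_of_forall h, mk_univ] at hUY
      exact hUY.false
    rw [Set.mem_union, not_or] at hx
    refine hx.1 (hYmax (y := insert x Y) ?_ (Set.subset_insert x Y) (Set.mem_insert x Y))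
    intro j u hu hinj
    by_cases hxu : ∃ i, u i = some x
    · obtain ⟨i, hi⟩ := hxu
      have hYu : ∀ k y, k ≠ i → u k = some y → y ∈ Y := fun k y hk h =>
        (hu k y h).resolve_left fun hyx => hk (hinj k i x (hyx ▸ h) hi)
      -- Blanking the slot of `x` leaves a partial tuple in `Y`, for which `x` is not bad.
      let v : ι → Option Y := fun k =>
        if hk : k = i then none else (u k).pmap (fun y hy => ⟨y, hy⟩) fun y hy => hYu k y hk hy
      have hv : ∀ k y, v k = some y → k ≠ i ∧ u k = some y.1 := by
        intro k y h
        by_cases hk : k = i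
        · simp [v, hk] at h
        · refine ⟨hk, ?_⟩
          simp only [v, hk, dite_false, Option.pmap_eq_some_iff] at h
          obtain ⟨a, ha, h, rfl⟩ := h
          exact h
      have hv' : ∀ k y (hk : k ≠ i) (h : u k = some y), v k = some ⟨y, hYu k y hk h⟩ := by
        intro k y hk h
        simp only [v, hk, dite_false, Option.pmap_eq_some_iff]
        exact ⟨y, hYu k y hk h, h, rfl⟩
      have hxb : x ∉ bad (j, i, v) := fun h => hx.2 (Set.mem_iUnion.2 ⟨_, h⟩)
      by_contra! hcon
      refine hxb ⟨fun k k' y h h' => hinj k k' y (hv k y h).2 (hv k' y h').2, by simp [v],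
        fun z hz => hcon _ fun k y h => ?_⟩
      by_cases hk : k = i
      · subst hk
        simpa [hi] using h
      · rw [Function.update_of_ne hk]
        exact hz k _ (hv' k y hk h)
    · refine hY j u (fun i y h => (hu i y h).resolve_left fun hyx => hxu ⟨i, hyx ▸ h⟩) hinj
  · obtain ⟨z', hz', h0⟩ := hY j (fun i => some (z i)) (fun i y h => by
      rw [← Option.some_injective _ h]; exact hzY i) (fun i i' y h h' => hz (by
      rw [Option.some_injective _ h, Option.some_injective _ h']))
    have : z' = z := funext fun i => hz' i _ rfl
    exact this ▸ h0

/-! ### Simplex volumes and Gram determinants -/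

/-- The Gram determinant of the edges issuing from the first of `k + 1` points. -/
noncomputable def gramDet {d k : ℕ} (x : Fin (k + 1) → EuclideanSpace ℝ (Fin d)) : ℝ :=
  (Matrix.gram ℝ fun i : Fin k => x i.succ - x 0).det

theorem gramDet_nonneg {d k : ℕ} (x : Fin (k + 1) → EuclideanSpace ℝ (Fin d)) :
    0 ≤ gramDet x :=
  (Matrix.posSemidef_gram ℝ _).det_nonneg

theorem gramDet_ne_zero_iff {d k : ℕ} (x : Fin (k + 1) → EuclideanSpace ℝ (Fin d)) :
    gramDet x ≠ 0 ↔ AffineIndependent ℝ x := by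
  rw [gramDet, Matrix.det_gram_ne_zero_iff_linearIndependent,
    affineIndependent_iff_linearIndependent_vsub ℝ x 0,
    ← linearIndependent_equiv (finSuccAboveEquiv (0 : Fin (k + 1)))]
  rfl

/-- The vertices of the standard simplex with a corner at the origin. -/
noncomputable def cornerVertex (k : ℕ) : Fin (k + 1) → EuclideanSpace ℝ (Fin k) :=
  Fin.cons 0 (EuclideanSpace.basisFun (Fin k) ℝ)

/-- Being nonzero and finite, this constant can be cancelled when volumes are compared. -/
theorem volume_convexHull_cornerVertex_ne_zero (k : ℕ) :
    volume (convexHull ℝ (Set.range (cornerVertex k))) ≠ 0 := by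
  have haff : AffineIndependent ℝ (cornerVertex k) := by
    rw [← gramDet_ne_zero_iff, gramDet, Matrix.det_gram_ne_zero_iff_linearIndependent]
    simpa only [cornerVertex, Fin.cons_succ, Fin.cons_zero, sub_zero,
      OrthonormalBasis.coe_toBasis] using
      (EuclideanSpace.basisFun (Fin k) ℝ).toBasis.linearIndependent
  have hspan : affineSpan ℝ (Set.range (cornerVertex k)) = ⊤ :=
    haff.affineSpan_eq_top_iff_card_eq_finrank_add_one.2 (by simp)
  have hne := interior_convexHull_nonempty_iff_affineSpan_eq_top.2 hspan
  exact (Measure.measure_pos_of_nonempty_interior volume hne).ne'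

theorem volume_convexHull_cornerVertex_ne_top (k : ℕ) :
    volume (convexHull ℝ (Set.range (cornerVertex k))) ≠ ⊤ :=
  (Set.finite_range (cornerVertex k)).isCompact_convexHull ℝ |>.measure_lt_top.ne

/-- The volume of a simplex is proportional to the square root of its Gram determinant. -/
theorem euclideanHausdorffMeasure_convexHull_range {d k : ℕ}
    (x : Fin (k + 1) → EuclideanSpace ℝ (Fin d)) :
    μHE[k] (convexHull ℝ (Set.range x)) =
      ENNReal.ofReal √(gramDet x) * volume (convexHull ℝ (Set.range (cornerVertex k))) := by
  let b := EuclideanSpace.basisFun (Fin k) ℝ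
  let f : EuclideanSpace ℝ (Fin k) →ₗ[ℝ] EuclideanSpace ℝ (Fin d) :=
    b.toBasis.constr ℝ fun i => x i.succ - x 0
  have hf : ∀ i, f (b i) = x i.succ - x 0 := fun i => by
    rw [← b.coe_toBasis]
    exact b.toBasis.constr_basis ℝ _ i
  let g : EuclideanSpace ℝ (Fin k) →ᵃ[ℝ] EuclideanSpace ℝ (Fin d) :=
    f.toAffineMap + AffineMap.const ℝ _ (x 0)
  have hg : ∀ v, g v = f v + x 0 := fun v => rfl
  have hgx : g ∘ cornerVertex k = x := by
    ext1 i
    refine Fin.cases ?_ (fun i => ?_) i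
    · simp [hg, cornerVertex]
    · have := hf i
      simp only [Function.comp_apply, hg, cornerVertex, Fin.cons_succ]
      rw [show f (EuclideanSpace.basisFun (Fin k) ℝ i) = _ from this, sub_add_cancel]
  have himage : convexHull ℝ (Set.range x) =
      IsometryEquiv.addRight (x 0) '' (f '' convexHull ℝ (Set.range (cornerVertex k))) := by
    conv_lhs => rw [← hgx, Set.range_comp, ← AffineMap.image_convexHull]
    rw [Set.image_image]
    rfl
  have hdet : f.normDet = √(gramDet x) := by
    rw [← Real.sqrt_sq f.normDet_nonneg]
    congr 1
    have := f.normDet_sq_eq_det_gram b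
    simp only [hf] at this
    exact this
  rw [himage, (IsometryEquiv.isometry _).euclideanHausdorffMeasure_image, ← hdet,
    ← EuclideanSpace.euclideanHausdorffMeasure_eq_volume]
  have := f.euclideanHausdorffMeasure_image (convexHull ℝ (Set.range (cornerVertex k)))
  rwa [finrank_euclideanSpace_fin] at this

theorem simplexVolume_eq {d k : ℕ} {s : Finset (EuclideanSpace ℝ (Fin d))}
    (hs : s.card = k + 1) {x : Fin (k + 1) → EuclideanSpace ℝ (Fin d)} (hx : Set.range x = s) :
    simplexVolume s =
      ENNReal.ofReal √(gramDet x) * volume (convexHull ℝ (Set.range (cornerVertex k))) := by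
  rw [simplexVolume, hs, ← hx]
  exact euclideanHausdorffMeasure_convexHull_range x

/-- The Gram determinant as a polynomial in the coordinates of a tuple of points. -/
noncomputable def gramPoly (d : ℕ) {k : ℕ} {ι : Type} (f : Fin (k + 1) → ι) :
    MvPolynomial (ι × Fin d) ℝ :=
  (Matrix.of fun i j : Fin k => ∑ c, (MvPolynomial.X (f i.succ, c) - MvPolynomial.X (f 0, c)) *
    (MvPolynomial.X (f j.succ, c) - MvPolynomial.X (f 0, c))).det

theorem eval_gramPoly {d k : ℕ} {ι : Type} (f : Fin (k + 1) → ι)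
    (z : ι → EuclideanSpace ℝ (Fin d)) :
    MvPolynomial.eval (fun q => z q.1 q.2) (gramPoly d f) = gramDet (z ∘ f) := by
  rw [gramPoly, RingHom.map_det, gramDet]
  congr 1
  ext i j
  simp [Matrix.gram_apply, PiLp.inner_apply, mul_comm]

/-- Unless two index tuples have the same range, their Gram determinants differ at some tuple of
points of any set that contains sufficiently many affinely independent points. -/
theorem exists_gramDet_comp_ne {d k : ℕ} {ι : Type} {X : Set (EuclideanSpace ℝ (Fin d))}
    {w : Fin (k + 2) → EuclideanSpace ℝ (Fin d)} (hw : AffineIndependent ℝ w) (hwX : ∀ i, w i ∈ X)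
    (f g : Fin (k + 2) ↪ ι) (hfg : Set.range f ≠ Set.range g) :
    ∃ z : ι → EuclideanSpace ℝ (Fin d), (∀ i, z i ∈ X) ∧ gramDet (z ∘ f) ≠ gramDet (z ∘ g) := by
  classical
  have hsub : ¬ Finset.univ.map g ⊆ Finset.univ.map f := fun h => hfg <| by
    have := congrArg (fun s : Finset ι => (s : Set ι))
      (Finset.eq_of_subset_of_card_le h (by simp))
    simpa using this.symm
  obtain ⟨i, hig, hif⟩ := Finset.not_subset.1 hsub
  obtain ⟨m, -, rfl⟩ := Finset.mem_map.1 hig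
  -- Moving the point at `g m` onto the one at `g m'` makes the simplex of `g` degenerate and leaves
  -- that of `f` intact.
  obtain ⟨m', hm'⟩ := exists_ne m
  let z₀ : ι → EuclideanSpace ℝ (Fin d) := Function.extend f w fun _ => w 0
  have hz₀ : ∀ i, z₀ i ∈ X := fun i => by
    by_cases h : ∃ a, f a = i
    · obtain ⟨a, rfl⟩ := h
      exact Set.mem_of_eq_of_mem (f.injective.extend_apply w _ a) (hwX a)
    · exact Set.mem_of_eq_of_mem (Function.extend_apply' w _ i h) (hwX 0)
  refine ⟨Function.update z₀ (g m) (z₀ (g m')), fun i => ?_, ?_⟩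
  · rcases eq_or_ne i (g m) with rfl | h
    · rw [Function.update_self]
      exact hz₀ _
    · rw [Function.update_of_ne h]
      exact hz₀ _
  · have hf : Function.update z₀ (g m) (z₀ (g m')) ∘ f = w := by
      ext1 a
      have : f a ≠ g m := fun h => hif (Finset.mem_map.2 ⟨a, Finset.mem_univ a, h⟩)
      rw [Function.comp_apply, Function.update_of_ne this]
      exact f.injective.extend_apply _ _ _
    have hg : gramDet (Function.update z₀ (g m) (z₀ (g m')) ∘ g) = 0 := by
      by_contra h
      refine hm' (((gramDet_ne_zero_iff _).1 h).injective ?_)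
      simp [g.injective.ne hm']
    rw [hf, hg]
    exact (gramDet_ne_zero_iff w).2 hw

/-- A set contains as many affinely independent points as its dimension allows. -/
theorem exists_affineIndependent_fin {d k : ℕ} {X : Set (EuclideanSpace ℝ (Fin d))}
    (hX : X.Nonempty) (hk : k ≤ Module.finrank ℝ (vectorSpan ℝ X)) :
    ∃ w : Fin (k + 1) → EuclideanSpace ℝ (Fin d), (∀ i, w i ∈ X) ∧ AffineIndependent ℝ w := by
  obtain ⟨t, htX, hspan, ht⟩ := exists_affineIndependent ℝ (EuclideanSpace ℝ (Fin d)) X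
  have : Finite t := finite_of_fin_dim_affineIndependent ℝ ht
  have : Fintype t := Fintype.ofFinite t
  have : Nonempty t := by
    rw [Set.nonempty_coe_sort, ← affineSpan_nonempty ℝ, hspan]
    exact (affineSpan_nonempty ℝ).2 hX
  have hcard := ht.finrank_vectorSpan_add_one
  rw [Subtype.range_coe, ← direction_affineSpan, hspan, direction_affineSpan] at hcard
  have hle : k + 1 ≤ Fintype.card t := hcard ▸ Nat.succ_le_succ hk
  have e : Fin (k + 1) ↪ t :=
    (Fin.castLEEmb hle).trans (Fintype.equivFin t).symm.toEmbedding
  exact ⟨fun i => e i, fun i => htX (e i).2, ht.comp_embedding e⟩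

/-! ### From generic tuples to rainbow sets -/

/-- A finite subset of an infinite set is covered by an injective tuple of any sufficient length. -/
theorem exists_embedding_range_superset {α : Type} {Y : Set α} (hY : Y.Infinite) {s : Finset α}
    (hs : (s : Set α) ⊆ Y) {n : ℕ} (hn : s.card ≤ n) :
    ∃ z : Fin n ↪ α, (∀ i, z i ∈ Y) ∧ (s : Set α) ⊆ Set.range z := by
  classical
  have := hY.to_subtype
  obtain ⟨t, hst, ht⟩ := Infinite.exists_superset_card_eq (s.subtype (· ∈ Y)) n
    ((Finset.card_subtype _ _).trans_le ((Finset.card_filter_le _ _).trans hn))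
  let e := (t.equivFinOfCardEq ht).symm
  refine ⟨⟨fun i => ((e i : Y) : α), fun i j h => e.injective (Subtype.ext (Subtype.ext h))⟩,
    fun i => (e i : Y).2, fun x hx => ?_⟩
  have hxt : (⟨x, hs hx⟩ : Y) ∈ t := hst (by simpa using hx)
  exact ⟨e.symm ⟨_, hxt⟩, congrArg (fun y : t => ((y : Y) : α)) (e.apply_symm_apply _)⟩

theorem exists_embedding_range_comp_eq {α ι : Type} (z : ι ↪ α) {s : Finset α} {m : ℕ}
    (hm : s.card = m) (hs : (s : Set α) ⊆ Set.range z) :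
    ∃ f : Fin m ↪ ι, Set.range (z ∘ f) = s := by
  let e := (s.equivFinOfCardEq hm).symm
  choose f hf using fun i => hs (e i).2
  refine ⟨⟨f, fun i j h => e.injective (Subtype.ext ?_)⟩, ?_⟩
  · rw [← hf i, ← hf j, h]
  · ext x
    refine ⟨?_, fun hx => ⟨e.symm ⟨x, hx⟩, ?_⟩⟩
    · rintro ⟨i, rfl⟩
      exact Set.mem_of_eq_of_mem (hf i) (e i).2
    · exact (hf _).trans (by simp)

/-- If every polynomial not vanishing on `X` has fewer than `#X` zeros there, then `X` contains an
equinumerous subset that is strongly rainbow up to the dimension of `X`. -/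
theorem exists_isStronglyRainbow {d : ℕ} {X : Set (EuclideanSpace ℝ (Fin d))}
    (hX : (#X).IsRegular)
    (hmin : ∀ p : MvPolynomial (Fin d) ℝ, (∃ x ∈ X, MvPolynomial.eval x p ≠ 0) →
      #{x : X | MvPolynomial.eval (x : EuclideanSpace ℝ (Fin d)) p = 0} < #X) :
    ∃ Y ⊆ X, #Y = #X ∧ ∀ b, 2 ≤ b → b ≤ Module.finrank ℝ (vectorSpan ℝ X) + 1 →
      IsStronglyRainbow b Y := by
  set D := Module.finrank ℝ (vectorSpan ℝ X) with hD
  have hXne : X.Nonempty := Set.nonempty_coe_sort.1 (mk_ne_zero_iff.1 hX.pos.ne')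
  -- Room for the union of two sets of at most `D + 1` points; below, `k : Fin D` encodes `b = k +
  -- 2`.
  let n := 2 * (D + 1)
  let T := Σ k : Fin D, (Fin (k + 2) ↪ Fin n)
  let U := Σ k : Fin D, {t : (Fin (k + 2) ↪ Fin n) × (Fin (k + 2) ↪ Fin n) //
    Set.range t.1 ≠ Set.range t.2}
  let P : T ⊕ U → MvPolynomial (Fin n × Fin d) ℝ :=
    Sum.elim (fun t => gramPoly d t.2) fun t => gramPoly d t.2.1.1 - gramPoly d t.2.1.2
  let φ : X → Fin d → ℝ := fun x => (x : EuclideanSpace ℝ (Fin d))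
  have hT : ∀ (t : T) z, evalTuple φ (P (.inl t)) z = gramDet ((Subtype.val ∘ z) ∘ t.2) :=
    fun t z => eval_gramPoly _ (Subtype.val ∘ z)
  have hU : ∀ (t : U) z, evalTuple φ (P (.inr t)) z =
      gramDet ((Subtype.val ∘ z) ∘ t.2.1.1) - gramDet ((Subtype.val ∘ z) ∘ t.2.1.2) := by
    intro t z
    rw [← eval_gramPoly, ← eval_gramPoly, ← map_sub]
    rfl
  have hU0 : ∀ t : U, ∃ z, evalTuple φ (P (.inr t)) z ≠ 0 := by
    rintro ⟨k, ⟨f, g⟩, hfg⟩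
    obtain ⟨w, hwX, hw⟩ := exists_affineIndependent_fin (k := k + 1) hXne (hD ▸ k.2)
    obtain ⟨z, hzX, hz⟩ := exists_gramDet_comp_ne hw hwX f g hfg
    refine ⟨fun i => ⟨z i, hzX i⟩, ?_⟩
    rw [hU]
    exact sub_ne_zero.2 hz
  have hT0 : ∀ t : T, ∃ z, evalTuple φ (P (.inl t)) z ≠ 0 := by
    rintro ⟨k, f⟩
    obtain ⟨w, hwX, hw⟩ := exists_affineIndependent_fin (k := k + 1) hXne (hD ▸ k.2)
    let w' : Fin (k + 2) → X := fun i => ⟨w i, hwX i⟩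
    refine ⟨Function.extend f w' fun _ => w' 0, ?_⟩
    have hext : Function.extend f w' (fun _ => w' 0) ∘ f = w' :=
      funext fun i => f.injective.extend_apply _ _ i
    rw [hT, Function.comp_assoc, hext]
    exact (gramDet_ne_zero_iff w).2 hw
  obtain ⟨Y, hYcard, hY⟩ := exists_generic_subset φ hX
    (fun p ⟨x, hx⟩ => hmin p ⟨x, x.2, hx⟩) P (Sum.forall.2 ⟨hT0, hU0⟩)
  have hcard : #(Subtype.val '' Y : Set (EuclideanSpace ℝ (Fin d))) = #X :=
    (mk_image_eq Subtype.val_injective).trans hYcard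
  have hinf : (Subtype.val '' Y : Set (EuclideanSpace ℝ (Fin d))).Infinite := by
    rw [← Set.infinite_coe_iff, infinite_iff, hcard]
    exact hX.aleph0_le
  have hlift : ∀ z : Fin n ↪ EuclideanSpace ℝ (Fin d), (∀ i, z i ∈ Subtype.val '' Y) →
      ∃ z' : Fin n → X, Function.Injective z' ∧ (∀ i, z' i ∈ Y) ∧ Subtype.val ∘ z' = z := by
    intro z hz
    choose z' hz' hzz' using hz
    have h : Subtype.val ∘ z' = z := funext hzz'
    exact ⟨z', Function.Injective.of_comp (f := Subtype.val) (h ▸ z.injective), hz', h⟩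
  refine ⟨Subtype.val '' Y, Subtype.coe_image_subset X Y, hcard, fun b hb hbD => ?_⟩
  obtain ⟨k, rfl⟩ : ∃ k, b = k + 2 := ⟨b - 2, by omega⟩
  have hk : k < D := by omega
  refine ⟨fun s hsY hs => ?_, fun s t hsY htY hs ht hst => ?_⟩
  · obtain ⟨z, hzY, hsz⟩ := exists_embedding_range_superset hinf hsY (n := n) (by omega)
    obtain ⟨f, hf⟩ := exists_embedding_range_comp_eq z hs hsz
    obtain ⟨z', hinj, hz'Y, hz'⟩ := hlift z hzY
    have h := hY (.inl ⟨⟨k, hk⟩, f⟩) z' hinj hz'Y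
    rw [hT, hz'] at h
    rw [simplexVolume_eq hs hf]
    refine mul_ne_zero ?_ (volume_convexHull_cornerVertex_ne_zero _)
    rw [ENNReal.ofReal_ne_zero_iff, Real.sqrt_pos]
    exact lt_of_le_of_ne (gramDet_nonneg _) h.symm
  · classical
    obtain ⟨z, hzY, hz⟩ := exists_embedding_range_superset hinf (s := s ∪ t)
      (by simpa using ⟨hsY, htY⟩) (n := n) ((Finset.card_union_le s t).trans (by omega))
    rw [Finset.coe_union, Set.union_subset_iff] at hz
    obtain ⟨f, hf⟩ := exists_embedding_range_comp_eq z hs hz.1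
    obtain ⟨g, hg⟩ := exists_embedding_range_comp_eq z ht hz.2
    have hfg : Set.range f ≠ Set.range g := fun h => hst <| by
      rw [← Finset.coe_inj, ← hf, ← hg, Set.range_comp, Set.range_comp, h]
    obtain ⟨z', hinj, hz'Y, hz'⟩ := hlift z hzY
    have h := hY (.inr ⟨⟨k, hk⟩, (f, g), hfg⟩) z' hinj hz'Y
    rw [hU, hz', sub_ne_zero] at h
    rw [simplexVolume_eq hs hf, simplexVolume_eq ht hg, Ne, ENNReal.mul_left_inj
      (volume_convexHull_cornerVertex_ne_zero _) (volume_convexHull_cornerVertex_ne_top _),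
      ENNReal.ofReal_eq_ofReal_iff (Real.sqrt_nonneg _) (Real.sqrt_nonneg _),
      Real.sqrt_inj (gramDet_nonneg _) (gramDet_nonneg _)]
    exact h

end Rainbow

theorem mainTheorem3 (d : ℕ) (κ : Cardinal.{0}) (hκ : κ.IsRegular) (hκc : κ ≤ 2 ^ ℵ₀)
    (X : Set (EuclideanSpace ℝ (Fin d))) (hX : #X = κ) :
    ∃ Y : Set (EuclideanSpace ℝ (Fin d)), Y ⊆ X ∧ #Y = κ ∧
      ∃ a : ℕ, 2 ≤ a ∧ a ≤ d + 1 ∧ Rainbow.IsStrictlyRainbow a Y := by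
  obtain ⟨X', hX'X, hX', hmin⟩ := Rainbow.exists_subset_mk_zeros_lt
    (fun (x : EuclideanSpace ℝ (Fin d)) (i : Fin d) => x i) X
  rw [hX] at hX' hmin
  obtain ⟨Y, hYX', hY, hrainbow⟩ := Rainbow.exists_isStronglyRainbow (X := X') (hX' ▸ hκ)
    (by rw [hX']; exact hmin)
  have hinf : X'.Infinite := by
    rw [← Set.infinite_coe_iff, infinite_iff, hX']
    exact hκ.aleph0_le
  -- A zero-dimensional `X'` would be a single point; hence `a ≥ 2`.
  have hpos : Module.finrank ℝ (vectorSpan ℝ X') ≠ 0 := fun h => by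
    rw [Submodule.finrank_eq_zero, vectorSpan_eq_bot_iff_subsingleton] at h
    exact hinf h.finite
  refine ⟨Y, hYX'.trans hX'X, hY.trans hX', Module.finrank ℝ (vectorSpan ℝ X') + 1, by omega, ?_,
    hrainbow, affineSpan ℝ X', ?_, by rw [direction_affineSpan],
    hYX'.trans (subset_affineSpan ℝ X')⟩
  · simpa using Submodule.finrank_le (vectorSpan ℝ X')
  · exact (affineSpan_nonempty ℝ).2 hinf.nonempty
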